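/- Let $d \ge 1$ and let $\mathcal P_2(\mathbb R^d)$ be the set of Borel probability measures on $\mathbb R^d$ with finite second moment. For $m \in \mathbb R^d$, $c > 0$ and a nonnegative measurable function $\rho$ on $[0,\infty)$, write $\mu = R_d(m,c,\rho)$ if $\mu \in \mathcal P_2(\mathbb R^d)$ and $\mathrm d\mu(x) = \frac1Z\,\rho\!\left(\frac{\|x-m\|}{c}\right)\mathrm dx$, where $Z>0$ is the normalizing constant. For $\mu,\nu\in\mathcal P_2(\mathbb R^d)$, a Monge map from $\mu$ to $\nu$ is a minimizer of $\int \|x-T(x)\|^2\,\mathrm d\mu(x)$ among the measurable maps $T:\mathbb R^d\to\mathbb R^d$ with $T_\#\mu=\nu$; a McCann interpolation between $\mu$ and $\nu$ is a path $\mu_t = ((1-t)\mathrm{Id}+tT)_\#\mu$, $0\le t\le 1$, where $T$ is a Monge map from $\mu$ to $\nu$; and $W_2(\mu,\nu)^2=\inf_\gamma\int\|x-y\|^2\,\mathrm d\gamma(x,y)$, where $\gamma$ runs over the measures on $\mathbb R^d\times\mathbb R^d$ with marginals $\mu$ and $\nu$. Let $\mu_0 = R_d(m_0,c_0,\rho)$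 and $\mu_1 = R_d(m_1,c_1,\rho)$ with the same generator $\rho$. Then: 1. The map $$T(x) = \frac{c_1}{c_0}(x-m_0)+m_1$$ is a Monge map from $\mu_0$ to $\mu_1$, and every Monge map from $\mu_0$ to $\mu_1$ equals $T$ $\mu_0$-almost everywhere. 2. The McCann interpolation between $\mu_0$ and $\mu_1$ is (uniquely) $\mu_t = R_d(m_t,c_t,\rho)$, where $m_t=(1-t)m_0+tm_1$ and $c_t=(1-t)c_0+tc_1$ for $0\le t\le 1$. 3. The integrals $\int_0^\infty r^{d+1}\rho(r)\,\mathrm dr$ and $\int_0^\infty r^{d-1}\rho(r)\,\mathrm dr$ are finite, the second one is positive, and $$W_2(\mu_0,\mu_1)^2 = \|m_0-m_1\|^2+(c_0-c_1)^2\,\frac{\int_0^{\infty} r^{d+1}\rho(r)\,\mathrm dr}{\int_0^{\infty} r^{d-1}\rho(r)\,\mathrm dr}.$$ -/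

import Mathlib

open MeasureTheory Set
open scoped ENNReal

/-- `μ` belongs to `P₂(ℝᵈ)`: a Borel probability measure with finite second moment. -/
structure InP2 {d : ℕ} (μ : Measure (EuclideanSpace ℝ (Fin d))) : Prop where
  isProbabilityMeasure : IsProbabilityMeasure μ
  secondMoment_lt_top : ∫⁻ x, ‖x‖ₑ ^ 2 ∂μ < ∞

/-- `μ = R_d(m, c, ρ)`: the measure `μ ∈ P₂(ℝᵈ)` is the radially contoured distribution with
center `m`, scale `c > 0` and generator `ρ`, a nonnegative measurable function on `[0, ∞)`
(values of `ρ` at negative reals play no role), i.e. `dμ(x) = Z⁻¹ ρ(‖x - m‖ / c) dx` where the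
number `Z > 0` normalizes the total mass to `1`. -/
structure IsRadiallyContoured {d : ℕ} (μ : Measure (EuclideanSpace ℝ (Fin d)))
    (m : EuclideanSpace ℝ (Fin d)) (c : ℝ) (ρ : ℝ → ℝ) : Prop where
  scale_pos : 0 < c
  generator_nonneg : ∀ r ∈ Ici (0 : ℝ), 0 ≤ ρ r
  generator_measurable : Measurable (fun r : Ici (0 : ℝ) => ρ r)
  inP2 : InP2 μ
  density : ∃ Z : ℝ, 0 < Z ∧
    μ = (volume : Measure (EuclideanSpace ℝ (Fin d))).withDensity
      (fun x => ENNReal.ofReal (Z⁻¹ * ρ (‖x - m‖ / c)))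

/-- `T` is a Monge map transporting `μ` to `ν`: it is measurable, `T_# μ = ν`, and it minimizes
`∫ ‖x - S x‖² dμ(x)` among all measurable `S` with `S_# μ = ν`. -/
structure IsMongeMap {d : ℕ} (μ ν : Measure (EuclideanSpace ℝ (Fin d)))
    (T : EuclideanSpace ℝ (Fin d) → EuclideanSpace ℝ (Fin d)) : Prop where
  measurable : Measurable T
  map_eq : μ.map T = ν
  le_cost : ∀ S : EuclideanSpace ℝ (Fin d) → EuclideanSpace ℝ (Fin d),
    Measurable S → μ.map S = ν → ∫⁻ x, ‖x - T x‖ₑ ^ 2 ∂μ ≤ ∫⁻ x, ‖x - S x‖ₑ ^ 2 ∂μ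

/-- The path `(μ t)`, `t ∈ [0, 1]`, is a McCann interpolation between `μ₀` and `μ₁`: it is
`μ t = ((1 - t) Id + t T)_# μ₀` for a Monge map `T` transporting `μ₀` to `μ₁`. -/
def IsMcCannInterpolation {d : ℕ} (μ₀ μ₁ : Measure (EuclideanSpace ℝ (Fin d)))
    (μ : ℝ → Measure (EuclideanSpace ℝ (Fin d))) : Prop :=
  ∃ T : EuclideanSpace ℝ (Fin d) → EuclideanSpace ℝ (Fin d), IsMongeMap μ₀ μ₁ T ∧
    ∀ t ∈ Icc (0 : ℝ) 1, μ t = μ₀.map (fun x => (1 - t) • x + t • T x)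

/-- The set `Π(μ, ν)` of couplings: measures on `ℝᵈ × ℝᵈ` with marginals `μ` and `ν`. -/
def couplings {d : ℕ} (μ ν : Measure (EuclideanSpace ℝ (Fin d))) :
    Set (Measure (EuclideanSpace ℝ (Fin d) × EuclideanSpace ℝ (Fin d))) :=
  {γ | γ.map Prod.fst = μ ∧ γ.map Prod.snd = ν}

/-- The 2-Wasserstein distance, `W₂(μ, ν)² = inf_{γ ∈ Π(μ, ν)} ∫ ‖x - y‖² dγ(x, y)`. -/
noncomputable def W2 {d : ℕ} (μ ν : Measure (EuclideanSpace ℝ (Fin d))) : ℝ≥0∞ :=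
  (⨅ γ ∈ couplings μ ν, ∫⁻ p, ‖p.1 - p.2‖ₑ ^ 2 ∂γ) ^ (1 / 2 : ℝ)

/-! ### Quadratic cost of random vectors -/

section SecondMoment

variable {Ω F : Type*} [MeasurableSpace Ω] [NormedAddCommGroup F]

/-! For `a = c₁ / c₀` and centred `U = x - m₀`, `V = y - m₁`, completing the square gives `‖U - V‖²
= a⁻¹‖V - aU‖² + (1 - a)‖U‖² + (1 - a⁻¹)‖V‖²`. Integrated against any coupling, the last two terms
depend on the marginals only, so the cost is a constant plus a weighted squared deviation from the
affine map (`lintegral_cost_coupling`). The affine map does push `μ₀` to `μ₁` (`map_affine_eq`), so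
it attains the constant; optimality, a.e. uniqueness and the value of `W₂` follow without duality.
Radial symmetry provides the means, and polar coordinates the second moments, which are `c²` times
one ratio of integrals. -/

theorem lintegral_enorm_sq_eq_ofReal_integral {μ : Measure Ω} {f : Ω → F} (hf : MemLp f 2 μ) :
    ∫⁻ x, ‖f x‖ₑ ^ 2 ∂μ = ENNReal.ofReal (∫ x, ‖f x‖ ^ 2 ∂μ) := by
  rw [ofReal_integral_eq_lintegral_ofReal
    ((memLp_two_iff_integrable_sq_norm hf.1).1 hf) (ae_of_all _ fun x => by positivity)]
  refine lintegral_congr fun x => ?_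
  rw [ENNReal.ofReal_pow (norm_nonneg _), ofReal_norm]

theorem memLp_two_iff_lintegral_enorm_sq_lt_top {μ : Measure Ω} {f : Ω → F}
    (hf : AEStronglyMeasurable f μ) : MemLp f 2 μ ↔ ∫⁻ x, ‖f x‖ₑ ^ 2 ∂μ < ∞ := by
  have := eLpNorm_lt_top_iff_lintegral_rpow_enorm_lt_top (f := f) (μ := μ) (p := 2)
    two_ne_zero ENNReal.ofNat_ne_top
  simp only [ENNReal.toReal_ofNat, ENNReal.rpow_ofNat] at this
  exact ⟨fun h => this.1 h.2, fun h => ⟨hf, this.2 h⟩⟩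

/-- The quadratic cost between two centred random vectors, shifted by `w`, splits into the
deviation from the linear relation `V = a • U` and terms depending on the marginals only. -/
theorem integral_norm_sub_add_sq [InnerProductSpace ℝ F] [CompleteSpace F] {γ : Measure Ω}
    [IsProbabilityMeasure γ] {U V : Ω → F} (hU : MemLp U 2 γ) (hV : MemLp V 2 γ)
    (hU0 : ∫ x, U x ∂γ = 0) (hV0 : ∫ x, V x ∂γ = 0) (w : F) {a : ℝ} (ha : a ≠ 0) :
    ∫ x, ‖U x - V x + w‖ ^ 2 ∂γ = a⁻¹ * ∫ x, ‖V x - a • U x‖ ^ 2 ∂γ +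
      ((1 - a) * ∫ x, ‖U x‖ ^ 2 ∂γ + (1 - a⁻¹) * ∫ x, ‖V x‖ ^ 2 ∂γ + ‖w‖ ^ 2) := by
  have sq {f : Ω → F} (hf : MemLp f 2 γ) : Integrable (fun x => ‖f x‖ ^ 2) γ :=
    (memLp_two_iff_integrable_sq_norm hf.1).1 hf
  have hUV : Integrable (fun x => U x - V x) γ :=
    (hU.integrable one_le_two).sub (hV.integrable one_le_two)
  have hinner : ∫ x, inner ℝ w (U x - V x) ∂γ = 0 := by
    rw [integral_inner hUV, integral_sub (hU.integrable one_le_two) (hV.integrable one_le_two),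
      hU0, hV0, sub_zero, inner_zero_right]
  have hW : MemLp (fun x => V x - a • U x) 2 γ := hV.sub (hU.const_smul a)
  -- The weight `a⁻¹` makes the cross term on the right `-2⟨U, V⟩`, as on the left.
  have key : ∀ x, ‖U x - V x + w‖ ^ 2 = a⁻¹ * ‖V x - a • U x‖ ^ 2 +
      ((1 - a) * ‖U x‖ ^ 2 + (1 - a⁻¹) * ‖V x‖ ^ 2 + (2 * inner ℝ w (U x - V x) + ‖w‖ ^ 2)) := by
    intro x
    rw [norm_add_sq_real, norm_sub_sq_real, norm_sub_sq_real, norm_smul, mul_pow,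
      Real.norm_eq_abs, sq_abs, inner_smul_right, real_inner_comm (U x) (V x),
      real_inner_comm w (U x - V x)]
    field_simp
    ring
  simp_rw [key]
  have i1 := (sq hW).const_mul a⁻¹
  have i2 := (sq hU).const_mul (1 - a)
  have i3 := (sq hV).const_mul (1 - a⁻¹)
  have i4 : Integrable (fun x => 2 * inner ℝ w (U x - V x)) γ := (hUV.const_inner w).const_mul 2
  have i5 : Integrable (fun _ : Ω => ‖w‖ ^ 2) γ := integrable_const _
  have i23 : Integrable (fun x => (1 - a) * ‖U x‖ ^ 2 + (1 - a⁻¹) * ‖V x‖ ^ 2) γ := i2.add i3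
  have i45 : Integrable (fun x => 2 * inner ℝ w (U x - V x) + ‖w‖ ^ 2) γ := i4.add i5
  have i2345 : Integrable (fun x => (1 - a) * ‖U x‖ ^ 2 + (1 - a⁻¹) * ‖V x‖ ^ 2 +
      (2 * inner ℝ w (U x - V x) + ‖w‖ ^ 2)) γ := i23.add i45
  rw [integral_add i1 i2345, integral_add i23 i45, integral_add i2 i3, integral_add i4 i5]
  simp only [integral_const_mul, hinner]
  simp

end SecondMoment

/-! ### Affine images and moments of radially contoured distributions -/

section Radial

variable {d : ℕ} {μ ν : Measure (EuclideanSpace ℝ (Fin d))} {m : EuclideanSpace ℝ (Fin d)} {c : ℝ}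
  {ρ : ℝ → ℝ}

theorem InP2.memLp_id (h : InP2 μ) : MemLp (fun x => x) 2 μ :=
  (memLp_two_iff_lintegral_enorm_sq_lt_top (by fun_prop)).2 h.secondMoment_lt_top

theorem InP2.map_affine (h : InP2 μ) (a : ℝ) (m m' : EuclideanSpace ℝ (Fin d)) :
    InP2 (μ.map fun x => a • (x - m) + m') := by
  have := h.isProbabilityMeasure
  have hf : Measurable fun x : EuclideanSpace ℝ (Fin d) => a • (x - m) + m' := by fun_prop
  refine ⟨Measure.isProbabilityMeasure_map hf.aemeasurable, ?_⟩
  rw [lintegral_map (by fun_prop) hf, ← memLp_two_iff_lintegral_enorm_sq_lt_top (by fun_prop)]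
  exact ((h.memLp_id.sub (memLp_const m)).const_smul a).add (memLp_const m')

namespace IsRadiallyContoured

theorem measurable_generator (h : IsRadiallyContoured μ m c ρ) (m' : EuclideanSpace ℝ (Fin d))
    {c' : ℝ} (hc' : 0 < c') :
    Measurable fun x : EuclideanSpace ℝ (Fin d) => ρ (‖x - m'‖ / c') :=
  h.generator_measurable.comp (Measurable.subtype_mk (by fun_prop)
    (h := fun x : EuclideanSpace ℝ (Fin d) => mem_Ici.2 (by positivity)))

/-- Total mass one forces `Z`. Equalities of measures thus reduce to comparing parameters. -/
theorem unique (h : IsRadiallyContoured μ m c ρ) (h' : IsRadiallyContoured ν m c ρ) : μ = ν := by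
  have hμ := h.inP2.isProbabilityMeasure
  have hν := h'.inP2.isProbabilityMeasure
  obtain ⟨Z, hZ, hμZ⟩ := h.density
  obtain ⟨W, hW, hνW⟩ := h'.density
  have hm : Measurable fun x : EuclideanSpace ℝ (Fin d) => ENNReal.ofReal (ρ (‖x - m‖ / c)) :=
    (h.measurable_generator m h.scale_pos).ennreal_ofReal
  have key : ∀ Y : ℝ, 0 < Y → (volume : Measure (EuclideanSpace ℝ (Fin d))).withDensity
      (fun x => ENNReal.ofReal (Y⁻¹ * ρ (‖x - m‖ / c))) = ENNReal.ofReal Y⁻¹ •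
        (volume : Measure (EuclideanSpace ℝ (Fin d))).withDensity
          (fun x => ENNReal.ofReal (ρ (‖x - m‖ / c))) := by
    intro Y hY
    rw [← withDensity_smul _ hm]
    congr 1
    ext x
    rw [Pi.smul_apply, smul_eq_mul, ENNReal.ofReal_mul (by positivity)]
  rw [key Z hZ] at hμZ
  rw [key W hW] at hνW
  have h1 := hμ.measure_univ
  have h2 := hν.measure_univ
  rw [hμZ, Measure.smul_apply, smul_eq_mul] at h1
  rw [hνW, Measure.smul_apply, smul_eq_mul] at h2
  rw [hμZ, hνW, ENNReal.eq_inv_of_mul_eq_one_left h1, ENNReal.eq_inv_of_mul_eq_one_left h2]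

/-- Affine images of radially contoured distributions are radially contoured. -/
theorem map_affine (h : IsRadiallyContoured μ m c ρ) {a : ℝ} (ha : a ≠ 0)
    (m' : EuclideanSpace ℝ (Fin d)) :
    IsRadiallyContoured (μ.map fun x => a • (x - m) + m') m' (|a| * c) ρ := by
  have ha' : 0 < |a| := abs_pos.2 ha
  have hc := h.scale_pos
  refine ⟨by positivity, h.generator_nonneg, h.generator_measurable, h.inP2.map_affine a m m', ?_⟩
  obtain ⟨Z, hZ, hμZ⟩ := h.density
  -- The Jacobian of the affine map multiplies the normalizing constant by `|a| ^ d`.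
  refine ⟨Z * |a| ^ d, by positivity, ?_⟩
  set f : EuclideanSpace ℝ (Fin d) → EuclideanSpace ℝ (Fin d) := fun x => a • (x - m) + m'
  have hf : Measurable f := by fun_prop
  set g : EuclideanSpace ℝ (Fin d) → ℝ≥0∞ :=
    fun y => ENNReal.ofReal (Z⁻¹ * ρ (‖y - m'‖ / (|a| * c))) with hg_def
  have hg : Measurable g :=
    ((h.measurable_generator m' (by positivity)).const_mul _).ennreal_ofReal
  have hvol : (volume : Measure (EuclideanSpace ℝ (Fin d))).map f =
      ENNReal.ofReal (|a| ^ d)⁻¹ • volume := by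
    have hcomp : f = (fun x => x + m') ∘ (fun x => a • x) ∘ (fun x => x - m) := rfl
    rw [hcomp, ← Measure.map_map (by fun_prop) (by fun_prop),
      ← Measure.map_map (by fun_prop) (by fun_prop), (measurePreserving_sub_right volume m).map_eq,
      Measure.map_addHaar_smul volume ha, Measure.map_smul,
      (measurePreserving_add_right volume m').map_eq, finrank_euclideanSpace_fin, abs_inv, abs_pow]
  have hgf : (fun x => ENNReal.ofReal (Z⁻¹ * ρ (‖x - m‖ / c))) = g ∘ f := by
    ext x
    simp only [hg_def, f, Function.comp_apply, add_sub_cancel_right, norm_smul, Real.norm_eq_abs]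
    rw [mul_div_mul_left _ _ ha'.ne']
  have hmap : μ.map f = ((volume : Measure (EuclideanSpace ℝ (Fin d))).map f).withDensity g := by
    ext s hs
    rw [Measure.map_apply hf hs, hμZ, withDensity_apply _ (hf hs), withDensity_apply _ hs,
      setLIntegral_map hs hg hf, hgf]
    rfl
  rw [hmap, hvol, withDensity_smul_measure, ← withDensity_smul _ hg]
  congr 1
  ext x
  rw [Pi.smul_apply, smul_eq_mul, hg_def, ← ENNReal.ofReal_mul (by positivity), mul_inv]
  congr 1
  ring

theorem map_scale (h : IsRadiallyContoured μ m c ρ) {c' : ℝ} (hc' : 0 < c')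
    (m' : EuclideanSpace ℝ (Fin d)) :
    IsRadiallyContoured (μ.map fun x => (c' / c) • (x - m) + m') m' c' ρ := by
  have hc := h.scale_pos
  have := h.map_affine (div_pos hc' hc).ne' m'
  rwa [abs_of_pos (div_pos hc' hc), div_mul_cancel₀ _ hc.ne'] at this

theorem memLp_sub_center (h : IsRadiallyContoured μ m c ρ) : MemLp (fun x => x - m) 2 μ := by
  have := h.inP2.isProbabilityMeasure
  exact h.inP2.memLp_id.sub (memLp_const m)

/-- The reflection `x ↦ 2m - x` keeps centre and scale, hence fixes `μ`; the integral equals its own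
negative. -/
theorem integral_sub_center (h : IsRadiallyContoured μ m c ρ) : ∫ x, (x - m) ∂μ = 0 := by
  have hr := h.map_affine (a := -1) (by norm_num) m
  rw [abs_neg, abs_one, one_mul] at hr
  have hs : ∫ x, (x - m) ∂μ = -∫ x, (x - m) ∂μ := by
    conv_lhs => rw [← hr.unique h]
    rw [integral_map (by fun_prop) (by fun_prop), ← integral_neg]
    simp
  rw [eq_neg_iff_add_eq_zero, ← two_smul ℝ] at hs
  exact (smul_eq_zero.1 hs).resolve_left two_ne_zero

/-- A radially contoured distribution with centre `0` and scale `1`: radial integrals. -/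
theorem standard_integral_radial (h : IsRadiallyContoured μ 0 1 ρ) (hd : 1 ≤ d) :
    ∃ K : ℝ, 0 < K ∧ ∀ k : ℕ,
      (Integrable (fun x => ‖x‖ ^ k) μ ↔
        IntegrableOn (fun r : ℝ => r ^ (d - 1) * (r ^ k * ρ r)) (Ioi 0)) ∧
      ∫ x, ‖x‖ ^ k ∂μ = K * ∫ r in Ioi (0 : ℝ), r ^ (d - 1) * (r ^ k * ρ r) := by
  obtain ⟨Z, hZ, hμZ⟩ := h.density
  have : Nonempty (Fin d) := ⟨⟨0, hd⟩⟩
  have hb : 0 < (volume : Measure (EuclideanSpace ℝ (Fin d))).real (Metric.ball 0 1) :=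
    ENNReal.toReal_pos (Metric.measure_ball_pos volume _ one_pos).ne' measure_ball_lt_top.ne
  -- `Z⁻¹` times the area of the unit sphere, from polar coordinates; it does not depend on `k`.
  refine ⟨Z⁻¹ * (d * (volume : Measure (EuclideanSpace ℝ (Fin d))).real (Metric.ball 0 1)),
    by positivity, fun k => ?_⟩
  have hm : Measurable fun x : EuclideanSpace ℝ (Fin d) =>
      ENNReal.ofReal (Z⁻¹ * ρ (‖x - 0‖ / 1)) :=
    ((h.measurable_generator 0 one_pos).const_mul _).ennreal_ofReal
  have hfin : ∀ᵐ x : EuclideanSpace ℝ (Fin d), ENNReal.ofReal (Z⁻¹ * ρ (‖x - 0‖ / 1)) < ∞ :=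
    ae_of_all _ fun x => ENNReal.ofReal_lt_top
  have hfun : (fun x : EuclideanSpace ℝ (Fin d) =>
      (ENNReal.ofReal (Z⁻¹ * ρ (‖x - 0‖ / 1))).toReal • ‖x‖ ^ k) =
      fun x => Z⁻¹ * (‖x‖ ^ k * ρ ‖x‖) := by
    ext x
    have := h.generator_nonneg ‖x‖ (norm_nonneg x)
    rw [sub_zero, div_one, ENNReal.toReal_ofReal (by positivity), smul_eq_mul]
    ring
  constructor
  · rw [hμZ, integrable_withDensity_iff_integrable_smul' hm hfin, hfun,
      integrable_const_mul_iff (by simpa using hZ.ne'),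
      integrable_fun_norm_addHaar volume (f := fun r : ℝ => r ^ k * ρ r),
      finrank_euclideanSpace_fin]
    rfl
  · rw [hμZ, integral_withDensity_eq_integral_toReal_smul hm hfin, hfun, integral_const_mul,
      integral_fun_norm_addHaar volume (fun r : ℝ => r ^ k * ρ r), finrank_euclideanSpace_fin]
    simp only [nsmul_eq_mul, smul_eq_mul]
    ring

theorem standard (h : IsRadiallyContoured μ m c ρ) :
    IsRadiallyContoured (μ.map fun x => (1 / c) • (x - m) + 0) 0 1 ρ :=
  h.map_scale one_pos 0

theorem integrableOn_radial (h : IsRadiallyContoured μ m c ρ) (hd : 1 ≤ d) :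
    IntegrableOn (fun r : ℝ => r ^ (d + 1) * ρ r) (Ioi 0) ∧
    IntegrableOn (fun r : ℝ => r ^ (d - 1) * ρ r) (Ioi 0) ∧
    0 < ∫ r in Ioi (0 : ℝ), r ^ (d - 1) * ρ r := by
  obtain ⟨K, hK, hrad⟩ := h.standard.standard_integral_radial hd
  have hp := h.standard.inP2.isProbabilityMeasure
  refine ⟨?_, ?_, ?_⟩
  · have := (hrad 2).1.1 ((memLp_two_iff_integrable_sq_norm (by fun_prop)).1
      h.standard.inP2.memLp_id)
    simpa only [← mul_assoc, ← pow_add, show d - 1 + 2 = d + 1 by lia] using this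
  · have := (hrad 0).1.1 (by simpa only [pow_zero] using integrable_const 1)
    simpa using this
  · have := (hrad 0).2
    simp only [pow_zero, one_mul, integral_const, probReal_univ, smul_eq_mul] at this
    exact pos_of_mul_pos_right (this ▸ one_pos) hK.le

theorem integral_norm_sub_center_sq (h : IsRadiallyContoured μ m c ρ) (hd : 1 ≤ d) :
    ∫ x, ‖x - m‖ ^ 2 ∂μ = c ^ 2 * ((∫ r in Ioi (0 : ℝ), r ^ (d + 1) * ρ r) /
      ∫ r in Ioi (0 : ℝ), r ^ (d - 1) * ρ r) := by
  obtain ⟨K, hK, hrad⟩ := h.standard.standard_integral_radial hd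
  have hp := h.standard.inP2.isProbabilityMeasure
  have hc := h.scale_pos
  have h0 := (hrad 0).2
  have h2 := (hrad 2).2
  have hpos := (h.integrableOn_radial hd).2.2
  simp only [pow_zero, one_mul, integral_const, probReal_univ, smul_eq_mul] at h0
  simp only [← mul_assoc, ← pow_add, show d - 1 + 2 = d + 1 by lia] at h2
  rw [integral_map (by fun_prop) (by fun_prop)] at h2
  simp only [add_zero, norm_smul, mul_pow, integral_const_mul, Real.norm_eq_abs, sq_abs] at h2
  -- The moment `k = 0` is the total mass one, which identifies `K`.
  have hK' : K = (∫ r in Ioi (0 : ℝ), r ^ (d - 1) * ρ r)⁻¹ := eq_inv_of_mul_eq_one_left h0.symm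
  rw [hK'] at h2
  rw [div_eq_inv_mul, ← h2]
  field_simp

end IsRadiallyContoured

end Radial

/-! ### Optimal transport between two radially contoured distributions -/

section Transport

variable {d : ℕ} {μ₀ μ₁ : Measure (EuclideanSpace ℝ (Fin d))} {m₀ m₁ : EuclideanSpace ℝ (Fin d)}
  {c₀ c₁ : ℝ} {ρ : ℝ → ℝ}

/-- The optimal transport cost between `R_d(m₀, c₀, ρ)` and `R_d(m₁, c₁, ρ)`. -/
noncomputable def radialCost {d : ℕ} (m₀ m₁ : EuclideanSpace ℝ (Fin d)) (c₀ c₁ : ℝ)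
    (ρ : ℝ → ℝ) : ℝ :=
  ‖m₀ - m₁‖ ^ 2 + (c₀ - c₁) ^ 2 *
    ((∫ r in Ioi (0 : ℝ), r ^ (d + 1) * ρ r) / ∫ r in Ioi (0 : ℝ), r ^ (d - 1) * ρ r)

theorem map_prodMk_mem_couplings {S : EuclideanSpace ℝ (Fin d) → EuclideanSpace ℝ (Fin d)}
    (hS : Measurable S) (hmap : μ₀.map S = μ₁) :
    μ₀.map (fun x => (x, S x)) ∈ couplings μ₀ μ₁ := by
  refine ⟨?_, ?_⟩
  · rw [Measure.map_map measurable_fst (by fun_prop)]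
    exact Measure.map_id
  · rw [Measure.map_map measurable_snd (by fun_prop)]
    exact hmap

/-- Being an equality, this yields both the lower bound for the cost and the equality case. -/
theorem lintegral_cost_coupling (hd : 1 ≤ d) (h₀ : IsRadiallyContoured μ₀ m₀ c₀ ρ)
    (h₁ : IsRadiallyContoured μ₁ m₁ c₁ ρ)
    {γ : Measure (EuclideanSpace ℝ (Fin d) × EuclideanSpace ℝ (Fin d))}
    (hγ : γ ∈ couplings μ₀ μ₁) :
    ∫⁻ p, ‖p.1 - p.2‖ₑ ^ 2 ∂γ = ENNReal.ofReal (c₁ / c₀)⁻¹ *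
      (∫⁻ p, ‖p.2 - ((c₁ / c₀) • (p.1 - m₀) + m₁)‖ₑ ^ 2 ∂γ) +
        ENNReal.ofReal (radialCost m₀ m₁ c₀ c₁ ρ) := by
  obtain ⟨hγ₀, hγ₁⟩ := hγ
  have hp₀ := h₀.inP2.isProbabilityMeasure
  have hc₀ := h₀.scale_pos
  have hc₁ := h₁.scale_pos
  have hγp : IsProbabilityMeasure γ := by
    refine ⟨?_⟩
    rw [← preimage_univ (f := Prod.fst), ← Measure.map_apply measurable_fst .univ, hγ₀,
      measure_univ]
  have hU : MemLp (fun p : EuclideanSpace ℝ (Fin d) × EuclideanSpace ℝ (Fin d) => p.1 - m₀) 2 γ :=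
    (hγ₀ ▸ h₀.memLp_sub_center).comp_of_map measurable_fst.aemeasurable
  have hV : MemLp (fun p : EuclideanSpace ℝ (Fin d) × EuclideanSpace ℝ (Fin d) => p.2 - m₁) 2 γ :=
    (hγ₁ ▸ h₁.memLp_sub_center).comp_of_map measurable_snd.aemeasurable
  have hU0 : ∫ p, (p.1 - m₀) ∂γ = 0 := by
    rw [← h₀.integral_sub_center, ← hγ₀, integral_map (by fun_prop) (by fun_prop)]
  have hV0 : ∫ p, (p.2 - m₁) ∂γ = 0 := by
    rw [← h₁.integral_sub_center, ← hγ₁, integral_map (by fun_prop) (by fun_prop)]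
  have hU2 : ∫ p, ‖p.1 - m₀‖ ^ 2 ∂γ = ∫ x, ‖x - m₀‖ ^ 2 ∂μ₀ := by
    rw [← hγ₀, integral_map (by fun_prop) (by fun_prop)]
  have hV2 : ∫ p, ‖p.2 - m₁‖ ^ 2 ∂γ = ∫ x, ‖x - m₁‖ ^ 2 ∂μ₁ := by
    rw [← hγ₁, integral_map (by fun_prop) (by fun_prop)]
  have hI := integral_norm_sub_add_sq hU hV hU0 hV0 (m₀ - m₁) (div_pos hc₁ hc₀).ne'
  have hW : MemLp (fun p : EuclideanSpace ℝ (Fin d) × EuclideanSpace ℝ (Fin d) =>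
      p.2 - m₁ - (c₁ / c₀) • (p.1 - m₀)) 2 γ := hV.sub (hU.const_smul (c₁ / c₀))
  have hD : MemLp (fun p : EuclideanSpace ℝ (Fin d) × EuclideanSpace ℝ (Fin d) =>
      p.1 - m₀ - (p.2 - m₁) + (m₀ - m₁)) 2 γ := (hU.sub hV).add (memLp_const _)
  have hcost : (1 - c₁ / c₀) * ∫ p, ‖p.1 - m₀‖ ^ 2 ∂γ +
      (1 - (c₁ / c₀)⁻¹) * ∫ p, ‖p.2 - m₁‖ ^ 2 ∂γ + ‖m₀ - m₁‖ ^ 2 =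
      radialCost m₀ m₁ c₀ c₁ ρ := by
    rw [hU2, hV2, h₀.integral_norm_sub_center_sq hd, h₁.integral_norm_sub_center_sq hd, radialCost]
    -- What remains is `(1 - a)c₀² + (1 - a⁻¹)c₁² = (c₀ - c₁)²` for `a = c₁ / c₀`.
    generalize (∫ r in Ioi (0 : ℝ), r ^ (d + 1) * ρ r) / _ = Q
    field_simp
    ring
  have hnonneg : 0 ≤ radialCost m₀ m₁ c₀ c₁ ρ := by
    -- The ratio of integrals is nonnegative because `c₀²` times it is a second moment.
    have hQ := h₀.integral_norm_sub_center_sq hd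
    have hQ0 : 0 ≤ ∫ x, ‖x - m₀‖ ^ 2 ∂μ₀ := integral_nonneg fun x => by positivity
    rw [hQ] at hQ0
    have := nonneg_of_mul_nonneg_right hQ0 (by positivity)
    rw [radialCost]
    positivity
  rw [hcost] at hI
  have e1 : ∀ p : EuclideanSpace ℝ (Fin d) × EuclideanSpace ℝ (Fin d),
      p.1 - p.2 = p.1 - m₀ - (p.2 - m₁) + (m₀ - m₁) := fun p => by abel
  have e2 : ∀ p : EuclideanSpace ℝ (Fin d) × EuclideanSpace ℝ (Fin d),
      p.2 - ((c₁ / c₀) • (p.1 - m₀) + m₁) = p.2 - m₁ - (c₁ / c₀) • (p.1 - m₀) := fun p => by abel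
  simp_rw [e1, e2]
  rw [lintegral_enorm_sq_eq_ofReal_integral hD, lintegral_enorm_sq_eq_ofReal_integral hW, hI,
    ENNReal.ofReal_add (mul_nonneg (by positivity) (integral_nonneg fun x => by positivity))
      hnonneg, ENNReal.ofReal_mul (by positivity)]

theorem lintegral_cost_map (hd : 1 ≤ d) (h₀ : IsRadiallyContoured μ₀ m₀ c₀ ρ)
    (h₁ : IsRadiallyContoured μ₁ m₁ c₁ ρ)
    {S : EuclideanSpace ℝ (Fin d) → EuclideanSpace ℝ (Fin d)}
    (hS : Measurable S) (hmap : μ₀.map S = μ₁) :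
    ∫⁻ x, ‖x - S x‖ₑ ^ 2 ∂μ₀ = ENNReal.ofReal (c₁ / c₀)⁻¹ *
      (∫⁻ x, ‖S x - ((c₁ / c₀) • (x - m₀) + m₁)‖ₑ ^ 2 ∂μ₀) +
        ENNReal.ofReal (radialCost m₀ m₁ c₀ c₁ ρ) := by
  have := lintegral_cost_coupling hd h₀ h₁ (map_prodMk_mem_couplings hS hmap)
  rwa [lintegral_map (by fun_prop) (by fun_prop), lintegral_map (by fun_prop) (by fun_prop)] at this

theorem map_affine_eq (h₀ : IsRadiallyContoured μ₀ m₀ c₀ ρ)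
    (h₁ : IsRadiallyContoured μ₁ m₁ c₁ ρ) :
    μ₀.map (fun x => (c₁ / c₀) • (x - m₀) + m₁) = μ₁ :=
  (h₀.map_scale h₁.scale_pos m₁).unique h₁

theorem lintegral_cost_affine (hd : 1 ≤ d) (h₀ : IsRadiallyContoured μ₀ m₀ c₀ ρ)
    (h₁ : IsRadiallyContoured μ₁ m₁ c₁ ρ) :
    ∫⁻ x, ‖x - ((c₁ / c₀) • (x - m₀) + m₁)‖ₑ ^ 2 ∂μ₀ =
      ENNReal.ofReal (radialCost m₀ m₁ c₀ c₁ ρ) := by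
  rw [lintegral_cost_map hd h₀ h₁ (by fun_prop) (map_affine_eq h₀ h₁)]
  simp

theorem isMongeMap_affine (hd : 1 ≤ d) (h₀ : IsRadiallyContoured μ₀ m₀ c₀ ρ)
    (h₁ : IsRadiallyContoured μ₁ m₁ c₁ ρ) :
    IsMongeMap μ₀ μ₁ (fun x => (c₁ / c₀) • (x - m₀) + m₁) := by
  refine ⟨by fun_prop, map_affine_eq h₀ h₁, fun S hS hmap => ?_⟩
  rw [lintegral_cost_affine hd h₀ h₁, lintegral_cost_map hd h₀ h₁ hS hmap]
  exact le_add_self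

theorem IsMongeMap.ae_eq_affine (hd : 1 ≤ d) (h₀ : IsRadiallyContoured μ₀ m₀ c₀ ρ)
    (h₁ : IsRadiallyContoured μ₁ m₁ c₁ ρ)
    {S : EuclideanSpace ℝ (Fin d) → EuclideanSpace ℝ (Fin d)} (hS : IsMongeMap μ₀ μ₁ S) :
    ∀ᵐ x ∂μ₀, S x = (c₁ / c₀) • (x - m₀) + m₁ := by
  have hle := hS.le_cost _ (by fun_prop) (map_affine_eq h₀ h₁)
  have hSm := hS.measurable
  have ha : 0 < c₁ / c₀ := div_pos h₁.scale_pos h₀.scale_pos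
  rw [lintegral_cost_affine hd h₀ h₁, lintegral_cost_map hd h₀ h₁ hSm hS.map_eq] at hle
  -- The constant `radialCost` is finite, so it cancels in `ℝ≥0∞` and leaves no deviation.
  have hzero : ENNReal.ofReal (c₁ / c₀)⁻¹ *
      (∫⁻ x, ‖S x - ((c₁ / c₀) • (x - m₀) + m₁)‖ₑ ^ 2 ∂μ₀) = 0 := by
    rw [← nonpos_iff_eq_zero]
    refine (ENNReal.add_le_add_iff_right (ENNReal.ofReal_ne_top
      (r := radialCost m₀ m₁ c₀ c₁ ρ))).1 ?_
    rwa [zero_add]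
  have hint := (mul_eq_zero.1 hzero).resolve_left (by simpa using inv_pos.2 ha)
  rw [lintegral_eq_zero_iff (by fun_prop)] at hint
  filter_upwards [hint] with x hx
  simpa [sub_eq_zero] using hx

theorem isRadiallyContoured_interpolation (h₀ : IsRadiallyContoured μ₀ m₀ c₀ ρ)
    (hc₁ : 0 < c₁) (m₁ : EuclideanSpace ℝ (Fin d)) {t : ℝ} (ht : t ∈ Icc (0 : ℝ) 1) :
    IsRadiallyContoured (μ₀.map fun x => (1 - t) • x + t • ((c₁ / c₀) • (x - m₀) + m₁))
      ((1 - t) • m₀ + t • m₁) ((1 - t) * c₀ + t * c₁) ρ := by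
  have hc₀ := h₀.scale_pos
  have hpos : 0 < (1 - t) * c₀ + t * c₁ := by
    rcases ht.1.eq_or_lt with rfl | h
    · simpa using hc₀
    · have := sub_nonneg.2 ht.2
      positivity
  convert! h₀.map_scale hpos ((1 - t) • m₀ + t • m₁) using 2
  ext1 x
  -- The interpolated map is itself the affine map from scale `c₀` to scale `c_t`.
  have : ((1 - t) * c₀ + t * c₁) / c₀ = (1 - t) + t * (c₁ / c₀) := by field_simp
  rw [this]
  module

theorem isMcCannInterpolation_iff (hd : 1 ≤ d) (h₀ : IsRadiallyContoured μ₀ m₀ c₀ ρ)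
    (h₁ : IsRadiallyContoured μ₁ m₁ c₁ ρ) (μ : ℝ → Measure (EuclideanSpace ℝ (Fin d))) :
    IsMcCannInterpolation μ₀ μ₁ μ ↔
      ∀ t ∈ Icc (0 : ℝ) 1, IsRadiallyContoured (μ t)
        ((1 - t) • m₀ + t • m₁) ((1 - t) * c₀ + t * c₁) ρ := by
  constructor
  · rintro ⟨S, hS, hμ⟩ t ht
    have : μ₀.map (fun x => (1 - t) • x + t • S x) =
        μ₀.map fun x => (1 - t) • x + t • ((c₁ / c₀) • (x - m₀) + m₁) := by
      refine Measure.map_congr ?_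
      filter_upwards [hS.ae_eq_affine hd h₀ h₁] with x hx
      rw [hx]
    rw [hμ t ht, this]
    exact isRadiallyContoured_interpolation h₀ h₁.scale_pos m₁ ht
  -- Conversely, the parameters determine each `μ t`, so the affine Monge map generates the path.
  · exact fun h => ⟨_, isMongeMap_affine hd h₀ h₁, fun t ht =>
      (h t ht).unique (isRadiallyContoured_interpolation h₀ h₁.scale_pos m₁ ht)⟩

theorem W2_sq_eq (hd : 1 ≤ d) (h₀ : IsRadiallyContoured μ₀ m₀ c₀ ρ)
    (h₁ : IsRadiallyContoured μ₁ m₁ c₁ ρ) :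
    W2 μ₀ μ₁ ^ 2 = ENNReal.ofReal (radialCost m₀ m₁ c₀ c₁ ρ) := by
  have hW : W2 μ₀ μ₁ ^ 2 = ⨅ γ ∈ couplings μ₀ μ₁, ∫⁻ p, ‖p.1 - p.2‖ₑ ^ 2 ∂γ := by
    rw [W2, ← ENNReal.rpow_natCast, ← ENNReal.rpow_mul]
    norm_num
  rw [hW]
  refine le_antisymm ?_ (le_iInf₂ fun γ hγ => ?_)
  · refine (iInf₂_le _ (map_prodMk_mem_couplings (by fun_prop) (map_affine_eq h₀ h₁))).trans ?_
    rw [lintegral_map (by fun_prop) (by fun_prop)]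
    exact (lintegral_cost_affine hd h₀ h₁).le
  · rw [lintegral_cost_coupling hd h₀ h₁ hγ]
    exact le_add_self

end Transport

theorem mainTheorem3 (d : ℕ) (hd : 1 ≤ d) (m₀ m₁ : EuclideanSpace ℝ (Fin d)) (c₀ c₁ : ℝ)
    (ρ : ℝ → ℝ) (μ₀ μ₁ : Measure (EuclideanSpace ℝ (Fin d)))
    (h₀ : IsRadiallyContoured μ₀ m₀ c₀ ρ) (h₁ : IsRadiallyContoured μ₁ m₁ c₁ ρ) :
    -- the affine map is a Monge map, and the only one up to `μ₀`-null sets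
    IsMongeMap μ₀ μ₁ (fun x => (c₁ / c₀) • (x - m₀) + m₁) ∧
    (∀ S : EuclideanSpace ℝ (Fin d) → EuclideanSpace ℝ (Fin d), IsMongeMap μ₀ μ₁ S →
      ∀ᵐ x ∂μ₀, S x = (c₁ / c₀) • (x - m₀) + m₁) ∧
    -- the McCann interpolation is the path `R_d(m_t, c_t, ρ)`
    (∀ μ : ℝ → Measure (EuclideanSpace ℝ (Fin d)),
      IsMcCannInterpolation μ₀ μ₁ μ ↔
        ∀ t ∈ Icc (0 : ℝ) 1, IsRadiallyContoured (μ t)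
          ((1 - t) • m₀ + t • m₁) ((1 - t) * c₀ + t * c₁) ρ) ∧
    -- the Wasserstein distance, where both integrals converge and the denominator is nonzero
    IntegrableOn (fun r : ℝ => r ^ (d + 1) * ρ r) (Ioi 0) ∧
    IntegrableOn (fun r : ℝ => r ^ (d - 1) * ρ r) (Ioi 0) ∧
    0 < ∫ r in Ioi (0 : ℝ), r ^ (d - 1) * ρ r ∧
    W2 μ₀ μ₁ ^ 2 = ENNReal.ofReal (‖m₀ - m₁‖ ^ 2 + (c₀ - c₁) ^ 2 *
      ((∫ r in Ioi (0 : ℝ), r ^ (d + 1) * ρ r) / ∫ r in Ioi (0 : ℝ), r ^ (d - 1) * ρ r)) :=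
  ⟨isMongeMap_affine hd h₀ h₁, fun _ hS => hS.ae_eq_affine hd h₀ h₁,
    isMcCannInterpolation_iff hd h₀ h₁, (h₀.integrableOn_radial hd).1,
    (h₀.integrableOn_radial hd).2.1, (h₀.integrableOn_radial hd).2.2, W2_sq_eq hd h₀ h₁⟩
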